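/- Let $\mathcal M=(S,A,T,R,\beta)$ be a finite Markov decision process with available action sets $A(s)\subseteq A$, transition probabilities $T(s'\mid s,a)$ and initial distribution $\beta$. *Components.* A strongly connected component (SCC) of a digraph on $S$ is a maximal set of vertices any two of which are joined by directed paths in both directions; it is closed if no edge leaves it. A terminal strongly connected component (TSCC) is a closed SCC that is reachable from some state $s$ with $\beta_s>0$. The TSCCs of $\mathcal M$ are those of the digraph with an edge $s\to s'$ whenever $T(s'\mid s,a)>0$ for some $a\in A(s)$; call them $r_1(\mathcal M),\dots,r_m(\mathcal M)$, let $r(\mathcal M)$ be their union and $\bar r(\mathcal M)=S\setminus r(\mathcal M)$. A stationary policy $\pi$ assigns to each $s$ a probability distribution $\pi(\cdot\mid s)$ on $A(s)$; it induces the Markov chain $\mathcal M_\pi$ with transition probabilities $T_\pi(s'\mid s)=\sum_{a\in A(s)}T(s'\mid s,a)\pi(a\mid s)$ and initial distribution $\beta$. The TSCCs of $\mathcal M_\pi$ are those of the digraph with an edge $s\to s'$ whenever $T_\pi(s'\mid s)>0$ (so they are its recurrent classes that are reachable from $\beta$), and $r(\mathcal M_\pi)$ is their union. *Class-preserving up to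 unichain (CPU).* A stationary policy $\pi$ is CPU if $r(\mathcal M_\pi)\subseteq r(\mathcal M)$ and, for every $k\in\{1,\dots,m\}$, the set $r_k(\mathcal M)$ is reachable and unichain in $\mathcal M_\pi$: it contains exactly one TSCC of $\mathcal M_\pi$, and exactly one closed communicating class of $\mathcal M_\pi$ (all its other states being transient in $\mathcal M_\pi$). *The set $Q_0$.* It consists of all $(x,y)=\big((x_{sa}),(y_{sa})\big)_{s\in S,\,a\in A(s)}$ with $x_{sa}\in[0,1]$, $y_{sa}\ge 0$ and $$\sum_{s\in S}\sum_{a\in A(s)}x_{sa}T(s'\mid s,a)=\sum_{a\in A(s')}x_{s'a}\quad\forall s'\in S,$$ $$\sum_{s\in S}\sum_{a\in A(s)}y_{sa}T(s'\mid s,a)=\sum_{a\in A(s')}(x_{s'a}+y_{s'a})-\beta_{s'}\quad\forall s'\in S,$$ $$\sum_{f\in\bar r(\mathcal M)}\sum_{a\in A(f)}x_{fa}=0 .$$ *Derived policy.* Put $x_s=\sum_{a\in A(s)}x_{sa}$ and $y_s=\sum_{a\in A(s)}y_{sa}$. A policy $\pi=\pi(x,y)$ derived from $(x,y)$ is a stationary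 policy with $\pi(a\mid s)=x_{sa}/x_s$ if $x_s>0$, $\pi(a\mid s)=y_{sa}/y_s$ if $x_s=0<y_s$ (for $a\in A(s)$), and $\pi(\cdot\mid s)$ arbitrary otherwise. **Lemma.** Let $(x,y)\in Q_0$ and let $\pi=\pi(x,y)$ be a policy derived from $(x,y)$. If $\pi$ is CPU, then the steady-state distribution (occupation measure) of $\pi$ exists and equals $x$: for all $s\in S$ and $a\in A(s)$, $$\mathrm{Pr}^\infty_\pi(s,a):=\lim_{n\to\infty}\frac1n\sum_{t=1}^n\Pr(S_t=s,A_t=a\mid\beta,\pi)=x_{sa}.$$ -/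

import Mathlib

open Filter Topology

noncomputable section

namespace SteadyState

/-! ### Strongly connected components of a digraph -/

/-- A strongly connected component of the digraph `E`: a maximal set of vertices any two of which
are joined by directed paths in both directions. -/
def IsSCC {S : Type*} (E : S → S → Prop) (C : Set S) : Prop :=
  Maximal (fun D : Set S => ∀ s ∈ D, ∀ s' ∈ D, Relation.ReflTransGen E s s') C

/-- A strongly connected component without outgoing edges. For the transition graph of a finite
Markov chain these are the closed communicating classes, i.e. the recurrent classes, whether or not
the chain can reach them from its initial distribution. -/
def IsClosedClass {S : Type*} (E : S → S → Prop) (C : Set S) : Prop :=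
  IsSCC E C ∧ ∀ s ∈ C, ∀ s', E s s' → s' ∈ C

/-- A terminal strongly connected component (TSCC) of the digraph `E` with initial distribution
`β`: a strongly connected component without outgoing edges that is reachable from some state of
positive initial probability. -/
def IsTSCC {S : Type*} (E : S → S → Prop) (β : S → ℝ) (C : Set S) : Prop :=
  IsClosedClass E C ∧ ∃ s₀, 0 < β s₀ ∧ ∃ s ∈ C, Relation.ReflTransGen E s₀ s

/-- The union of all TSCCs. -/
def tsccUnion {S : Type*} (E : S → S → Prop) (β : S → ℝ) : Set S :=
  {s | ∃ C, IsTSCC E β C ∧ s ∈ C}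

/-! ### Markov decision processes -/

/-- A finite Markov decision process. `avail s` is the set of actions available in `s`, and
`T s a s'` is the probability of moving from `s` to `s'` under action `a`; its values at
unavailable actions play no role. -/
structure MDP (S A : Type*) [Fintype S] where
  avail : S → Finset A
  T : S → A → S → ℝ
  R : S → A → S → ℝ
  β : S → ℝ
  T_nonneg : ∀ s, ∀ a ∈ avail s, ∀ s', 0 ≤ T s a s'
  T_sum : ∀ s, ∀ a ∈ avail s, ∑ s', T s a s' = 1
  β_nonneg : ∀ s, 0 ≤ β s
  β_sum : ∑ s, β s = 1

variable {S A : Type*} [Fintype S]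

/-- A stationary policy: `prob s a` is the probability `π(a|s)` of playing `a` in `s`. -/
structure Policy (M : MDP S A) where
  prob : S → A → ℝ
  nonneg : ∀ s a, 0 ≤ prob s a
  eq_zero : ∀ s, ∀ a ∉ M.avail s, prob s a = 0
  sum_eq_one : ∀ s, ∑ a ∈ M.avail s, prob s a = 1

namespace MDP

/-- Edges of the transition graph of the MDP. -/
def Edge (M : MDP S A) (s s' : S) : Prop :=
  ∃ a ∈ M.avail s, 0 < M.T s a s'

/-- The TSCCs of the MDP. -/
def IsTSCC (M : MDP S A) (C : Set S) : Prop :=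
  SteadyState.IsTSCC M.Edge M.β C

/-- The union of the TSCCs of the MDP. -/
def recurrentSet (M : MDP S A) : Set S :=
  tsccUnion M.Edge M.β

open Classical in
/-- The constraint set `Q₀`. -/
structure Feasible (M : MDP S A) (x y : S → A → ℝ) : Prop where
  stationary : ∀ s', ∑ s, ∑ a ∈ M.avail s, x s a * M.T s a s' = ∑ a ∈ M.avail s', x s' a
  balance : ∀ s', ∑ s, ∑ a ∈ M.avail s, y s a * M.T s a s' =
    ∑ a ∈ M.avail s', (x s' a + y s' a) - M.β s'
  transient : ∑ f with f ∉ M.recurrentSet, ∑ a ∈ M.avail f, x f a = 0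
  x_nonneg : ∀ s, ∀ a ∈ M.avail s, 0 ≤ x s a
  x_le_one : ∀ s, ∀ a ∈ M.avail s, x s a ≤ 1
  y_nonneg : ∀ s, ∀ a ∈ M.avail s, 0 ≤ y s a

end MDP

namespace Policy

variable {M : MDP S A}

/-- The transition function `T_π(s'|s)` of the Markov chain induced by the policy. -/
def trans (π : Policy M) (s s' : S) : ℝ :=
  ∑ a ∈ M.avail s, M.T s a s' * π.prob s a

/-- Edges of the transition graph of the induced Markov chain. -/
def Edge (π : Policy M) (s s' : S) : Prop :=
  0 < π.trans s s'

/-- The recurrent classes (closed communicating classes) of the induced Markov chain. -/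
def IsRecurrentClass (π : Policy M) (D : Set S) : Prop :=
  IsClosedClass π.Edge D

/-- The TSCCs of the induced Markov chain, i.e. its reachable recurrent classes. -/
def IsTSCC (π : Policy M) (D : Set S) : Prop :=
  SteadyState.IsTSCC π.Edge M.β D

/-- The union of the TSCCs of the induced Markov chain. -/
def recurrentSet (π : Policy M) : Set S :=
  tsccUnion π.Edge M.β

/-- The policy is class-preserving up to unichain: the TSCCs of the induced chain lie in those of
the MDP, each TSCC of the MDP contains a unique TSCC of the induced chain, and each TSCC of the MDP
is unichain in the induced chain, i.e. contains a single closed communicating class of it. -/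
structure IsCPU (π : Policy M) : Prop where
  recurrentSet_subset : π.recurrentSet ⊆ M.recurrentSet
  existsUnique_tscc : ∀ C, M.IsTSCC C → ∃! D, π.IsTSCC D ∧ D ⊆ C
  unichain : ∀ C, M.IsTSCC C → ∃! D, π.IsRecurrentClass D ∧ D ⊆ C

/-- `π` is a policy `π(x,y)` derived from `(x,y)`; it is arbitrary in the states `s` in which
neither `x_s = ∑ a, x s a` nor `y_s = ∑ a, y s a` is positive. -/
structure IsDerivedFrom (π : Policy M) (x y : S → A → ℝ) : Prop where
  of_x : ∀ s, 0 < ∑ a ∈ M.avail s, x s a →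
    ∀ a ∈ M.avail s, π.prob s a = x s a / ∑ b ∈ M.avail s, x s b
  of_y : ∀ s, ¬ 0 < ∑ a ∈ M.avail s, x s a → 0 < ∑ a ∈ M.avail s, y s a →
    ∀ a ∈ M.avail s, π.prob s a = y s a / ∑ b ∈ M.avail s, y s b

/-- The probability of the state-action trajectory `h = ((s₀, a₀), …, (s_t, a_t))` when `s₀` is
drawn from `β`, each `a_i` from `π(·|s_i)` and each `s_{i+1}` from `T(·|s_i, a_i)`. -/
def trajProb (π : Policy M) (t : ℕ) (h : Fin (t + 1) → S × A) : ℝ :=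
  M.β (h 0).1 * (∏ i : Fin (t + 1), π.prob (h i).1 (h i).2) *
    ∏ i : Fin t, M.T (h i.castSucc).1 (h i.castSucc).2 (h i.succ).1

open Classical in
/-- `Pr(S_t = s, A_t = a | β, π)`: the total probability of the trajectories up to time `t` that
end in `(s, a)`. -/
def stateActionProb [Fintype A] (π : Policy M) (t : ℕ) (s : S) (a : A) : ℝ :=
  ∑ h : Fin (t + 1) → S × A with h (Fin.last t) = (s, a), π.trajProb t h

/-- `μ` is the steady-state distribution (occupation measure) of the policy: for every state `s`
and available action `a`, the limit of `(1/n) ∑_{t=1}^n Pr(S_t = s, A_t = a | β, π)` exists and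
equals `μ s a`. -/
def HasSteadyStateDistribution [Fintype A] (π : Policy M) (μ : S → A → ℝ) : Prop :=
  ∀ s, ∀ a ∈ M.avail s,
    Tendsto (fun n : ℕ => (1 / (n : ℝ)) * ∑ t ∈ Finset.Icc 1 n, π.stateActionProb t s a)
      atTop (𝓝 (μ s a))

end Policy

end SteadyState

end

/-!
Let `P` be the transition matrix of `π`. An indicator function `φ` of a set `C` that no edge of the
MDP leaves is constant on every TSCC, and so are the functions `P ^ n φ`, the probabilities of being
in `C` after `n` steps. Inside the TSCCs the flow `y` need not follow `π`, but testing the balance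
equations against a function that is constant there makes the difference invisible, so that
`β · P ^ n φ = x · φ - y · (P ^ (n + 1) φ - P ^ n φ)`. Since `P ^ n φ` increases to a limit, the
last term vanishes and the mass of `C` at time `n` tends to `x(C)`: the mass of each TSCC converges
to its `x`-mass, and the mass outside all TSCCs to `0`.

A cluster point of the Cesàro means of the distributions is therefore a stationary vector with the
same mass as `x` on each TSCC. The states at which a stationary signed vector is positive form an
absorbing set, which contains a closed class of the chain if it is nonempty. Hence, on a unichain
TSCC, the difference of the two vectors cannot take both signs, and having mass `0` it vanishes.
-/

namespace SteadyState

open Finset Matrix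

section Digraph

variable {V : Type*} {E : V → V → Prop} {C D : Set V}

/-- A set of vertices that no edge leaves; it need not be strongly connected. -/
def IsAbsorbing (E : V → V → Prop) (C : Set V) : Prop :=
  ∀ s ∈ C, ∀ s', E s s' → s' ∈ C

theorem IsAbsorbing.mem_of_reflTransGen (hC : IsAbsorbing E C) {s s' : V} (hs : s ∈ C)
    (h : Relation.ReflTransGen E s s') : s' ∈ C := by
  induction h with
  | refl => exact hs
  | tail _ hedge ih => exact hC _ ih _ hedge

theorem IsAbsorbing.inter (hC : IsAbsorbing E C) (hD : IsAbsorbing E D) :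
    IsAbsorbing E (C ∩ D) :=
  fun s hs s' h => ⟨hC s hs.1 s' h, hD s hs.2 s' h⟩

theorem isAbsorbing_setOf_reflTransGen (s : V) :
    IsAbsorbing E {s' | Relation.ReflTransGen E s s'} :=
  fun _ ht _ h => ht.tail h

theorem IsAbsorbing.exists_isClosedClass_subset [Finite V] (hD : IsAbsorbing E D)
    (hne : D.Nonempty) : ∃ C ⊆ D, C.Nonempty ∧ IsClosedClass E C := by
  obtain ⟨C, hCD, ⟨hCne, hC⟩, hmin⟩ :=
    exists_minimal_le_of_wellFoundedLT (fun C => C.Nonempty ∧ IsAbsorbing E C) D ⟨hne, hD⟩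
  have hconn : ∀ s ∈ C, ∀ s' ∈ C, Relation.ReflTransGen E s s' := fun s hs s' hs' =>
    hmin ⟨⟨s, .refl⟩, isAbsorbing_setOf_reflTransGen s⟩
      (fun _ ht => hC.mem_of_reflTransGen hs ht) hs'
  obtain ⟨s, hs⟩ := hCne
  exact ⟨C, hCD, ⟨s, hs⟩, ⟨hconn, fun D' hD' hle t ht =>
    hC.mem_of_reflTransGen hs (hD' s (hle hs) t ht)⟩, hC⟩

theorem isAbsorbing_tsccUnion (E : V → V → Prop) (β : V → ℝ) :
    IsAbsorbing E (tsccUnion E β) :=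
  fun s ⟨C, hC, hs⟩ s' h => ⟨C, hC, hC.1.2 s hs s' h⟩

theorem IsAbsorbing.mem_iff_of_edge {β : V → ℝ} (hC : IsAbsorbing E C) {s s' : V}
    (hs : s ∈ tsccUnion E β) (h : E s s') : s' ∈ C ↔ s ∈ C := by
  obtain ⟨D, ⟨⟨hconn, hclosed⟩, -⟩, hsD⟩ := hs
  have hback : Relation.ReflTransGen E s' s := hconn.prop s' (hclosed s hsD s' h) s hsD
  exact ⟨fun hs' => hC.mem_of_reflTransGen hs' hback, fun hs => hC s hs s' h⟩

end Digraph

section MarkovChain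

variable {S : Type*} {P : Matrix S S ℝ} {C : Set S}

/-- Edges of the transition graph of the Markov chain with transition matrix `P`. -/
def PosEdge (P : Matrix S S ℝ) (s s' : S) : Prop :=
  0 < P s s'

variable [Fintype S]

theorem tendsto_apply_zero_of_tendsto_mass_one {v : ℕ → S → ℝ} (hv : ∀ n, v n ∈ stdSimplex ℝ S)
    (hmass : Tendsto (fun n => v n ⬝ᵥ C.indicator 1) atTop (𝓝 1)) {s : S} (hs : s ∉ C) :
    Tendsto (fun n => v n s) atTop (𝓝 0) := by
  classical
  have hlim := hmass.const_sub 1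
  rw [sub_self] at hlim
  refine squeeze_zero (fun n => (hv n).1 s) (fun n => ?_) hlim
  have hle : Pi.single s 1 + C.indicator 1 ≤ (1 : S → ℝ) := by
    intro t
    rcases eq_or_ne t s with rfl | hts
    · simp [hs]
    · simpa [hts] using Set.indicator_le_self' (s := C) (f := (1 : S → ℝ))
        (fun _ _ => zero_le_one) t
  have hdot := dotProduct_le_dotProduct_of_nonneg_left hle (hv n).1
  rw [dotProduct_add, dotProduct_one, (hv n).2, dotProduct_single_one] at hdot
  linarith

theorem mulVec_mono_of_nonneg (hP : ∀ s s', 0 ≤ P s s') {φ ψ : S → ℝ} (h : φ ≤ ψ) :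
    P *ᵥ φ ≤ P *ᵥ ψ :=
  fun s => dotProduct_le_dotProduct_of_nonneg_left h (hP s)

variable [DecidableEq S]

theorem mulVec_indicator_one_mem_Icc (hP : P ∈ rowStochastic ℝ S) (C : Set S) :
    P *ᵥ C.indicator 1 ∈ Set.Icc (0 : S → ℝ) 1 := by
  constructor
  · exact nonneg_mulVec_of_mem_rowStochastic hP (Set.indicator_nonneg fun _ _ => zero_le_one)
  · simpa [hP.2] using mulVec_mono_of_nonneg hP.1
      (Set.indicator_le_self' (s := C) (f := (1 : S → ℝ)) fun _ _ => zero_le_one)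

theorem isAbsorbing_iff_indicator_le_mulVec (hP : P ∈ rowStochastic ℝ S) :
    IsAbsorbing (PosEdge P) C ↔ C.indicator 1 ≤ P *ᵥ C.indicator 1 := by
  classical
  have hrow (s : S) : (P *ᵥ C.indicator 1) s = ∑ s', if s' ∈ C then P s s' else 0 := by
    simp [mulVec, dotProduct, Set.indicator_apply]
  constructor
  · refine fun hC => Set.indicator_le' (fun s hs => ?_)
      fun s _ => (mulVec_indicator_one_mem_Icc hP C).1 s
    have hstay (s' : S) : (if s' ∈ C then P s s' else 0) = P s s' := by
      refine ite_eq_left_iff.2 fun hs' => ?_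
      exact ((hP.1 s s').eq_or_lt).resolve_right fun h => hs' (hC s hs s' h)
    rw [hrow, sum_congr rfl fun s' _ => hstay s', sum_row_of_mem_rowStochastic hP]
    rfl
  · intro hle s hs s' hpos
    by_contra hs'
    have hlt : ∑ t, (if t ∈ C then P s t else 0) < ∑ t, P s t :=
      sum_lt_sum (fun t _ => by split_ifs; exacts [le_rfl, hP.1 s t])
        ⟨s', mem_univ s', by rw [if_neg hs']; exact hpos⟩
    have hone := hle s
    rw [Set.indicator_of_mem hs, Pi.one_apply, hrow] at hone
    exact (hlt.trans_eq (sum_row_of_mem_rowStochastic hP s)).not_ge hone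

theorem isAbsorbing_setOf_pos_of_stationary (hP : P ∈ rowStochastic ℝ S) {d : S → ℝ}
    (hd : d ᵥ* P = d) : IsAbsorbing (PosEdge P) {s | 0 < d s} := by
  set f : S → ℝ := {s | 0 < d s}.indicator 1
  have hPf := mulVec_indicator_one_mem_Icc hP {s | 0 < d s}
  have hterm : ∀ s ∈ univ, 0 ≤ d s * (f s - (P *ᵥ f) s) := by
    intro s _
    by_cases hs : 0 < d s
    · simpa [f, hs] using hPf.2 s
    · simpa [f, hs] using mul_nonneg_of_nonpos_of_nonpos (not_lt.1 hs) (neg_nonpos.2 (hPf.1 s))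
  have hsum : ∑ s, d s * (f s - (P *ᵥ f) s) = 0 := by
    change d ⬝ᵥ (f - P *ᵥ f) = 0
    rw [dotProduct_sub, dotProduct_mulVec, hd, sub_self]
  refine (isAbsorbing_iff_indicator_le_mulVec hP).2 (Set.indicator_le' (fun s hs => ?_)
    fun s _ => hPf.1 s)
  have hzero := (sum_eq_zero_iff_of_nonneg hterm).1 hsum s (mem_univ s)
  have heq := (mul_eq_zero.1 hzero).resolve_left hs.ne'
  simpa [f, Set.indicator_of_mem hs] using (sub_eq_zero.1 heq).le

theorem nonneg_or_nonpos_of_stationary (hP : P ∈ rowStochastic ℝ S)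
    (hC : IsAbsorbing (PosEdge P) C)
    (huni : {D | IsClosedClass (PosEdge P) D ∧ D ⊆ C}.Subsingleton) {d : S → ℝ}
    (hd : d ᵥ* P = d) : (∀ s ∈ C, 0 ≤ d s) ∨ ∀ s ∈ C, d s ≤ 0 := by
  by_contra! ⟨⟨t, htC, ht⟩, s, hsC, hs⟩
  have hneg : (-d) ᵥ* P = -d := by rw [neg_vecMul, hd]
  obtain ⟨D, hD, ⟨u, hu⟩, hDclass⟩ := (hC.inter
    (isAbsorbing_setOf_pos_of_stationary hP hd)).exists_isClosedClass_subset ⟨s, hsC, hs⟩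
  obtain ⟨D', hD', -, hDclass'⟩ := (hC.inter
    (isAbsorbing_setOf_pos_of_stationary hP hneg)).exists_isClosedClass_subset
      ⟨t, htC, neg_pos.2 ht⟩
  have heq : D = D' :=
    huni ⟨hDclass, fun v hv => (hD hv).1⟩ ⟨hDclass', fun v hv => (hD' hv).1⟩
  have hpos : 0 < d u := (hD hu).2
  have hpos' : 0 < -d u := (hD' (heq ▸ hu)).2
  linarith

theorem eqOn_of_stationary_of_mass_eq (hP : P ∈ rowStochastic ℝ S)
    (hC : IsAbsorbing (PosEdge P) C)
    (huni : {D | IsClosedClass (PosEdge P) D ∧ D ⊆ C}.Subsingleton) {μ ν : S → ℝ}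
    (hμ : μ ᵥ* P = μ) (hν : ν ᵥ* P = ν) (hmass : μ ⬝ᵥ C.indicator 1 = ν ⬝ᵥ C.indicator 1) :
    Set.EqOn μ ν C := by
  classical
  have hd : (μ - ν) ᵥ* P = μ - ν := by rw [sub_vecMul, hμ, hν]
  have hsum : ∑ s with s ∈ C, (μ - ν) s = 0 := by
    rw [← sub_eq_zero, ← sub_dotProduct] at hmass
    rw [sum_filter]
    simpa only [dotProduct, Set.indicator_apply, Pi.one_apply, mul_ite, mul_one, mul_zero]
      using hmass
  have hzero : ∀ s ∈ univ.filter (· ∈ C), (μ - ν) s = 0 := by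
    rcases nonneg_or_nonpos_of_stationary hP hC huni hd with h | h
    · exact (sum_eq_zero_iff_of_nonneg fun s hs => h s (by simpa using hs)).1 hsum
    · exact (sum_eq_zero_iff_of_nonpos fun s hs => h s (by simpa using hs)).1 hsum
  exact fun s hs => sub_eq_zero.1 (hzero s (by simpa using hs))

variable {β : S → ℝ}

theorem exists_tendsto_pow_mulVec_indicator (hP : P ∈ rowStochastic ℝ S)
    (hC : IsAbsorbing (PosEdge P) C) :
    ∃ φ, Tendsto (fun n => P ^ n *ᵥ C.indicator 1) atTop (𝓝 φ) := by
  refine ⟨_, tendsto_atTop_ciSup (monotone_nat_of_le_succ fun n => ?_) ⟨1, ?_⟩⟩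
  · rw [pow_succ, ← mulVec_mulVec]
    exact mulVec_mono_of_nonneg (pow_mem hP n).1
      ((isAbsorbing_iff_indicator_le_mulVec hP).1 hC)
  · rintro _ ⟨n, rfl⟩
    exact (mulVec_indicator_one_mem_Icc (pow_mem hP n) C).2

theorem tendsto_mass_of_balance (hP : P ∈ rowStochastic ℝ S) (hC : IsAbsorbing (PosEdge P) C)
    {x y : S → ℝ} (hx : x ᵥ* P = x)
    (hbal : ∀ n, y ⬝ᵥ P ^ (n + 1) *ᵥ C.indicator 1 + β ⬝ᵥ P ^ n *ᵥ C.indicator 1 =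
      (x + y) ⬝ᵥ P ^ n *ᵥ C.indicator 1) :
    Tendsto (fun n => (β ᵥ* P ^ n) ⬝ᵥ C.indicator 1) atTop (𝓝 (x ⬝ᵥ C.indicator 1)) := by
  obtain ⟨φ, hφ⟩ := exists_tendsto_pow_mulVec_indicator hP hC
  have hxpow (n : ℕ) : x ᵥ* P ^ n = x := by
    induction n with
    | zero => simp
    | succ n ih => rw [pow_succ, ← vecMul_vecMul, ih, hx]
  have hdot : Continuous fun ψ : S → ℝ => y ⬝ᵥ ψ := continuous_const.dotProduct continuous_id
  have hy := (hdot.tendsto φ).comp hφ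
  have hlim := tendsto_const_nhds (x := x ⬝ᵥ C.indicator 1) |>.sub
    ((hy.comp (tendsto_add_atTop_nat 1)).sub hy)
  rw [sub_self, sub_zero] at hlim
  refine hlim.congr fun n => ?_
  have hn := hbal n
  rw [add_dotProduct, dotProduct_mulVec x, hxpow, dotProduct_mulVec β] at hn
  simp only [Function.comp_apply]
  linarith

theorem vecMul_mem_stdSimplex (hP : P ∈ rowStochastic ℝ S) (hβ : β ∈ stdSimplex ℝ S) :
    β ᵥ* P ∈ stdSimplex ℝ S := by
  refine ⟨nonneg_vecMul_of_mem_rowStochastic hP hβ.1, ?_⟩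
  simpa [dotProduct_one, hβ.2] using vecMul_dotProduct_one_eq_one_rowStochastic hP (x := β)

/-- The average of the distributions at times `1, …, n` of the Markov chain with transition matrix
`P` and initial distribution `β`; time `0` is left out, and the value at `n = 0` is `0`. -/
noncomputable def cesaroMean (P : Matrix S S ℝ) (β : S → ℝ) (n : ℕ) : S → ℝ :=
  (n : ℝ)⁻¹ • ∑ t ∈ Icc 1 n, β ᵥ* P ^ t

theorem cesaroMean_mem_stdSimplex (hP : P ∈ rowStochastic ℝ S) (hβ : β ∈ stdSimplex ℝ S) {n : ℕ}
    (hn : n ≠ 0) : cesaroMean P β n ∈ stdSimplex ℝ S := by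
  rw [cesaroMean, smul_sum]
  exact (convex_stdSimplex ℝ S).sum_mem (fun _ _ => by positivity) (by simp [hn])
    fun t _ => vecMul_mem_stdSimplex (pow_mem hP t) hβ

theorem tendsto_cesaroMean_dotProduct {w : S → ℝ} {l : ℝ}
    (h : Tendsto (fun n => (β ᵥ* P ^ n) ⬝ᵥ w) atTop (𝓝 l)) :
    Tendsto (fun n => cesaroMean P β n ⬝ᵥ w) atTop (𝓝 l) := by
  refine (h.comp (tendsto_add_atTop_nat 1)).cesaro.congr fun n => ?_
  rw [cesaroMean, smul_dotProduct, sum_dotProduct, ← Ico_add_one_right_eq_Icc, range_eq_Ico]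
  exact congrArg _ (sum_Ico_add' (fun t => (β ᵥ* P ^ t) ⬝ᵥ w) 0 n 1)

theorem cesaroMean_vecMul_sub_cesaroMean (n : ℕ) :
    cesaroMean P β n ᵥ* P - cesaroMean P β n = (n : ℝ)⁻¹ • (β ᵥ* P ^ (n + 1) - β ᵥ* P) := by
  have hstep (t : ℕ) : (β ᵥ* P ^ t) ᵥ* P = β ᵥ* P ^ (t + 1) := by rw [vecMul_vecMul, ← pow_succ]
  rw [cesaroMean, smul_vecMul, sum_vecMul, ← smul_sub, ← sum_sub_distrib,
    ← Ico_add_one_right_eq_Icc]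
  simp only [hstep]
  rw [sum_Ico_sub (fun t => β ᵥ* P ^ t) (by lia), pow_one]

theorem tendsto_cesaroMean_vecMul_sub_cesaroMean (hP : P ∈ rowStochastic ℝ S)
    (hβ : β ∈ stdSimplex ℝ S) :
    Tendsto (fun n => cesaroMean P β n ᵥ* P - cesaroMean P β n) atTop (𝓝 0) := by
  obtain ⟨c, hc⟩ := (bounded_stdSimplex S).exists_norm_le
  have hbound (t : ℕ) : ‖β ᵥ* P ^ t‖ ≤ c := hc _ (vecMul_mem_stdSimplex (pow_mem hP t) hβ)
  simp only [cesaroMean_vecMul_sub_cesaroMean]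
  refine tendsto_inv_atTop_nhds_zero_nat.zero_smul_isBoundedUnder_le
    (isBoundedUnder_of ⟨c + c, fun n => ?_⟩)
  exact norm_sub_le_of_le (hbound (n + 1)) (by simpa using hbound 1)

theorem tendsto_cesaroMean_of_tendsto_mass (hP : P ∈ rowStochastic ℝ S) (hβ : β ∈ stdSimplex ℝ S)
    {x : S → ℝ} (hx : x ᵥ* P = x) {𝒞 : Set (Set S)}
    (hC : ∀ C ∈ 𝒞, IsAbsorbing (PosEdge P) C)
    (huni : ∀ C ∈ 𝒞, {D | IsClosedClass (PosEdge P) D ∧ D ⊆ C}.Subsingleton)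
    (hmass : ∀ C ∈ 𝒞,
      Tendsto (fun n => (β ᵥ* P ^ n) ⬝ᵥ C.indicator 1) atTop (𝓝 (x ⬝ᵥ C.indicator 1)))
    (hout : ∀ s ∉ ⋃₀ 𝒞, Tendsto (fun n => (β ᵥ* P ^ n) s) atTop (𝓝 (x s))) :
    Tendsto (cesaroMean P β) atTop (𝓝 x) := by
  have hmem : ∀ᶠ n in atTop, cesaroMean P β n ∈ stdSimplex ℝ S :=
    (eventually_ne_atTop 0).mono fun n hn => cesaroMean_mem_stdSimplex hP hβ hn
  refine (isCompact_stdSimplex ℝ S).tendsto_nhds_of_unique_mapClusterPt hmem fun μ _ hμ => ?_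
  obtain ⟨k, hk, hkμ⟩ := hμ.tendsto_subseq
  have hdot {w : S → ℝ} {l : ℝ} (h : Tendsto (fun n => (β ᵥ* P ^ n) ⬝ᵥ w) atTop (𝓝 l)) :
      μ ⬝ᵥ w = l :=
    tendsto_nhds_unique (((continuous_id.dotProduct continuous_const).tendsto μ).comp hkμ)
      ((tendsto_cesaroMean_dotProduct h).comp hk.tendsto_atTop)
  have hμstat : μ ᵥ* P = μ := sub_eq_zero.1 <| tendsto_nhds_unique
    ((((continuous_id.matrix_vecMul continuous_const).sub continuous_id).tendsto μ).comp hkμ)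
    ((tendsto_cesaroMean_vecMul_sub_cesaroMean hP hβ).comp hk.tendsto_atTop)
  funext s
  by_cases hs : s ∈ ⋃₀ 𝒞
  · obtain ⟨C, hC𝒞, hsC⟩ := hs
    exact eqOn_of_stationary_of_mass_eq hP (hC C hC𝒞) (huni C hC𝒞) hμstat hx
      (hdot (hmass C hC𝒞)) hsC
  · simpa using hdot (w := Pi.single s 1) (by simpa using hout s hs)

end MarkovChain

variable {S A : Type*} [Fintype S] {M : MDP S A}

namespace MDP

/-- The state totals `x_s = ∑ a ∈ A(s), x_{sa}` of a vector indexed by state-action pairs. -/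
def stateTotal (M : MDP S A) (x : S → A → ℝ) (s : S) : ℝ :=
  ∑ a ∈ M.avail s, x s a

/-- The function `φ` is constant on every TSCC of the MDP, stated along single edges: a TSCC is
strongly connected and no edge leaves it. -/
def ConstOnTSCCs (M : MDP S A) (φ : S → ℝ) : Prop :=
  ∀ s ∈ M.recurrentSet, ∀ s', M.Edge s s' → φ s' = φ s

theorem initial_mem_stdSimplex (M : MDP S A) : M.β ∈ stdSimplex ℝ S :=
  ⟨M.β_nonneg, M.β_sum⟩

theorem sum_T_mul_of_edge_eq {φ : S → ℝ} {s : S} (hφ : ∀ s', M.Edge s s' → φ s' = φ s) {a : A}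
    (ha : a ∈ M.avail s) : ∑ s', M.T s a s' * φ s' = φ s := by
  rw [← one_mul (φ s), ← M.T_sum s a ha, sum_mul]
  refine sum_congr rfl fun s' _ => ?_
  rcases (M.T_nonneg s a ha s').eq_or_lt with h | h
  · rw [← h, zero_mul, zero_mul]
  · rw [hφ s' ⟨a, ha, h⟩]

theorem isAbsorbing_recurrentSet (M : MDP S A) : IsAbsorbing M.Edge M.recurrentSet :=
  isAbsorbing_tsccUnion M.Edge M.β

theorem constOnTSCCs_indicator (M : MDP S A) {C : Set S} (hC : IsAbsorbing M.Edge C) :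
    M.ConstOnTSCCs (C.indicator 1) := by
  classical
  intro s hs s' h
  simp only [Set.indicator_apply, hC.mem_iff_of_edge hs h, Pi.one_apply]

namespace Feasible

variable {x y : S → A → ℝ}

theorem stateTotal_x_nonneg (hxy : M.Feasible x y) (s : S) : 0 ≤ M.stateTotal x s :=
  sum_nonneg (hxy.x_nonneg s)

theorem stateTotal_y_nonneg (hxy : M.Feasible x y) (s : S) : 0 ≤ M.stateTotal y s :=
  sum_nonneg (hxy.y_nonneg s)

theorem stateTotal_x_eq_zero (hxy : M.Feasible x y) {s : S} (hs : s ∉ M.recurrentSet) :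
    M.stateTotal x s = 0 :=
  (sum_eq_zero_iff_of_nonneg fun t _ => hxy.stateTotal_x_nonneg t).1 hxy.transient s (by simp [hs])

theorem sum_balance (hxy : M.Feasible x y) (φ : S → ℝ) :
    ∑ s, ∑ a ∈ M.avail s, y s a * ∑ s', M.T s a s' * φ s' + M.β ⬝ᵥ φ =
      (M.stateTotal x + M.stateTotal y) ⬝ᵥ φ := by
  have hswap : ∑ s, ∑ a ∈ M.avail s, y s a * ∑ s', M.T s a s' * φ s' =
      ∑ s', (∑ s, ∑ a ∈ M.avail s, y s a * M.T s a s') * φ s' := by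
    simp only [sum_mul, mul_sum, ← mul_assoc]
    rw [sum_comm (s := univ (α := S)) (t := univ)]
    exact sum_congr rfl fun s _ => sum_comm
  rw [hswap]
  simp only [hxy.balance, dotProduct, ← sum_add_distrib, Pi.add_apply, stateTotal]
  exact sum_congr rfl fun s _ => by ring

end Feasible

end MDP

namespace Policy

variable (π : Policy M)

/-- The transition matrix of the Markov chain induced by the policy; `PosEdge` of it is `π.Edge` by
definition. -/
def transMatrix : Matrix S S ℝ :=
  Matrix.of π.trans

theorem edge_of_posEdge {s s' : S} (h : PosEdge π.transMatrix s s') : M.Edge s s' := by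
  have hsum : 0 < ∑ a ∈ M.avail s, M.T s a s' * π.prob s a := h
  obtain ⟨a, ha, hpos⟩ := exists_lt_of_sum_lt (sum_const_zero.trans_lt hsum)
  exact ⟨a, ha, pos_of_mul_pos_left hpos (π.nonneg s a)⟩

theorem transMatrix_mem_rowStochastic [DecidableEq S] : π.transMatrix ∈ rowStochastic ℝ S := by
  refine mem_rowStochastic_iff_sum.2 ⟨fun s s' => sum_nonneg fun a ha =>
    mul_nonneg (M.T_nonneg s a ha s') (π.nonneg s a), fun s => ?_⟩
  simp only [transMatrix, of_apply, trans]
  rw [sum_comm, ← π.sum_eq_one s]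
  exact sum_congr rfl fun a ha => by rw [← sum_mul, M.T_sum s a ha, one_mul]

theorem transMatrix_mulVec_apply (φ : S → ℝ) (s : S) :
    (π.transMatrix *ᵥ φ) s = ∑ a ∈ M.avail s, π.prob s a * ∑ s', M.T s a s' * φ s' := by
  simp only [transMatrix, mulVec, dotProduct, of_apply, trans, sum_mul, mul_sum]
  rw [sum_comm]
  exact sum_congr rfl fun a _ => sum_congr rfl fun s' _ => by ring

theorem transMatrix_mulVec_apply_of_edge_eq {φ : S → ℝ} {s : S}
    (hφ : ∀ s', M.Edge s s' → φ s' = φ s) : (π.transMatrix *ᵥ φ) s = φ s := by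
  rw [transMatrix_mulVec_apply, ← one_mul (φ s), ← π.sum_eq_one s, sum_mul]
  exact sum_congr rfl fun a ha => by rw [MDP.sum_T_mul_of_edge_eq hφ ha]

theorem constOnTSCCs_pow_mulVec [DecidableEq S] {φ : S → ℝ} (hφ : M.ConstOnTSCCs φ) (n : ℕ) :
    M.ConstOnTSCCs (π.transMatrix ^ n *ᵥ φ) := by
  induction n with
  | zero => simpa using hφ
  | succ n ih =>
    intro s hs s' h
    rw [pow_succ', ← mulVec_mulVec, π.transMatrix_mulVec_apply_of_edge_eq (ih s hs),
      π.transMatrix_mulVec_apply_of_edge_eq (ih s' (M.isAbsorbing_recurrentSet s hs s' h)),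
      ih s hs s' h]

section Trajectories

theorem trajProb_snoc (t : ℕ) (h : Fin (t + 1) → S × A) (p : S × A) :
    π.trajProb (t + 1) (Fin.snoc (α := fun _ => S × A) h p) =
      π.trajProb t h * M.T (h (Fin.last t)).1 (h (Fin.last t)).2 p.1 * π.prob p.1 p.2 := by
  have hzero : (Fin.snoc (α := fun _ => S × A) h p : Fin (t + 2) → S × A) 0 = h 0 := by
    rw [← Fin.castSucc_zero, Fin.snoc_castSucc]
  simp only [trajProb, hzero]
  rw [Fin.prod_univ_castSucc (n := t + 1), Fin.prod_univ_castSucc (n := t)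
    (fun i : Fin (t + 1) => M.T _ _ _)]
  simp only [Fin.snoc_castSucc, Fin.snoc_last, Fin.succ_last, Fin.succ_castSucc]
  ring

variable [Fintype A]

theorem stateActionProb_zero (s : S) (a : A) :
    π.stateActionProb 0 s a = M.β s * π.prob s a := by
  classical
  simp only [stateActionProb, sum_filter]
  rw [← (Equiv.funUnique (Fin 1) (S × A)).symm.sum_comp, sum_eq_single (s, a)]
  · simp [trajProb, Equiv.funUnique]
  · intro p _ hp
    simp [Equiv.funUnique, hp]
  · simp

theorem stateActionProb_succ (t : ℕ) (s' : S) (a' : A) :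
    π.stateActionProb (t + 1) s' a' =
      (∑ s, ∑ a, π.stateActionProb t s a * M.T s a s') * π.prob s' a' := by
  classical
  have hlast : π.stateActionProb (t + 1) s' a' = ∑ h : Fin (t + 1) → S × A,
      π.trajProb t h * M.T (h (Fin.last t)).1 (h (Fin.last t)).2 s' * π.prob s' a' := by
    simp only [stateActionProb, sum_filter]
    rw [← (Fin.snocEquiv fun _ : Fin (t + 2) => S × A).sum_comp, Fintype.sum_prod_type, sum_comm]
    refine sum_congr rfl fun h _ => ?_
    rw [sum_eq_single (s', a')]
    · simp [Fin.snocEquiv, trajProb_snoc]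
    · intro p _ hp
      simp [Fin.snocEquiv, hp]
    · simp
  rw [hlast, ← sum_mul, ← Fintype.sum_prod_type' fun s a => π.stateActionProb t s a * M.T s a s',
    ← sum_fiberwise univ fun h : Fin (t + 1) → S × A => h (Fin.last t)]
  congr 1
  refine sum_congr rfl fun p _ => ?_
  simp only [stateActionProb, sum_mul]
  refine sum_congr (by ext; simp) fun h hh => ?_
  rw [(mem_filter.1 hh).2]

theorem stateActionProb_eq [DecidableEq S] (t : ℕ) (s : S) (a : A) :
    π.stateActionProb t s a = (M.β ᵥ* π.transMatrix ^ t) s * π.prob s a := by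
  induction t generalizing s a with
  | zero => simpa using π.stateActionProb_zero s a
  | succ t ih =>
    rw [stateActionProb_succ, pow_succ, ← vecMul_vecMul]
    congr 1
    refine sum_congr rfl fun u _ => ?_
    change _ = _ * ∑ b ∈ M.avail u, M.T u b s * π.prob u b
    rw [mul_sum, ← sum_subset (subset_univ (M.avail u))]
    · exact sum_congr rfl fun b _ => by rw [ih]; ring
    · intro b _ hb
      rw [ih, π.eq_zero u b hb, mul_zero, zero_mul]

end Trajectories

namespace IsDerivedFrom

variable {π} {x y : S → A → ℝ}

theorem stateTotal_x_mul_prob (hπ : π.IsDerivedFrom x y) (hxy : M.Feasible x y) {s : S} {a : A}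
    (ha : a ∈ M.avail s) : M.stateTotal x s * π.prob s a = x s a := by
  rcases (hxy.stateTotal_x_nonneg s).eq_or_lt with h | h
  · rw [← h, zero_mul, (sum_eq_zero_iff_of_nonneg (hxy.x_nonneg s)).1 h.symm a ha]
  · rw [hπ.of_x s h a ha]
    exact mul_div_cancel₀ _ h.ne'

theorem stateTotal_y_mul_prob (hπ : π.IsDerivedFrom x y) (hxy : M.Feasible x y) {s : S}
    (hs : s ∉ M.recurrentSet) {a : A} (ha : a ∈ M.avail s) :
    M.stateTotal y s * π.prob s a = y s a := by
  rcases (hxy.stateTotal_y_nonneg s).eq_or_lt with h | h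
  · rw [← h, zero_mul, (sum_eq_zero_iff_of_nonneg (hxy.y_nonneg s)).1 h.symm a ha]
  · rw [hπ.of_y s (hxy.stateTotal_x_eq_zero hs).not_gt h a ha]
    exact mul_div_cancel₀ _ h.ne'

theorem stateTotal_x_vecMul (hπ : π.IsDerivedFrom x y) (hxy : M.Feasible x y) :
    M.stateTotal x ᵥ* π.transMatrix = M.stateTotal x := by
  funext s'
  refine Eq.trans (sum_congr rfl fun s _ => ?_) (hxy.stationary s')
  change M.stateTotal x s * ∑ a ∈ M.avail s, M.T s a s' * π.prob s a = _
  rw [mul_sum]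
  exact sum_congr rfl fun a ha => by rw [← hπ.stateTotal_x_mul_prob hxy ha]; ring

theorem balance_of_constOnTSCCs (hπ : π.IsDerivedFrom x y) (hxy : M.Feasible x y) {φ : S → ℝ}
    (hφ : M.ConstOnTSCCs φ) :
    M.stateTotal y ⬝ᵥ π.transMatrix *ᵥ φ + M.β ⬝ᵥ φ =
      (M.stateTotal x + M.stateTotal y) ⬝ᵥ φ := by
  rw [← hxy.sum_balance φ]
  congr 1
  refine sum_congr rfl fun s _ => ?_
  by_cases hs : s ∈ M.recurrentSet
  · rw [π.transMatrix_mulVec_apply_of_edge_eq (hφ s hs), MDP.stateTotal, sum_mul]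
    exact sum_congr rfl fun a ha => by rw [MDP.sum_T_mul_of_edge_eq (hφ s hs) ha]
  · rw [π.transMatrix_mulVec_apply, mul_sum]
    exact sum_congr rfl fun a ha => by rw [← mul_assoc, hπ.stateTotal_y_mul_prob hxy hs ha]

theorem stateTotal_x_dotProduct_indicator_recurrentSet (hπ : π.IsDerivedFrom x y)
    (hxy : M.Feasible x y) : M.stateTotal x ⬝ᵥ M.recurrentSet.indicator 1 = 1 := by
  classical
  have htotal := hπ.balance_of_constOnTSCCs hxy (φ := 1) fun _ _ _ _ => rfl
  rw [π.transMatrix_mem_rowStochastic.2, add_dotProduct, dotProduct_one M.β, M.β_sum] at htotal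
  have hsupp : M.stateTotal x ⬝ᵥ M.recurrentSet.indicator 1 = M.stateTotal x ⬝ᵥ 1 := by
    refine sum_congr rfl fun s _ => ?_
    by_cases hs : s ∈ M.recurrentSet
    · rw [Set.indicator_of_mem hs]
    · rw [hxy.stateTotal_x_eq_zero hs, zero_mul, zero_mul]
  linarith

variable [DecidableEq S]

theorem tendsto_mass (hπ : π.IsDerivedFrom x y) (hxy : M.Feasible x y) {C : Set S}
    (hC : IsAbsorbing M.Edge C) :
    Tendsto (fun n => (M.β ᵥ* π.transMatrix ^ n) ⬝ᵥ C.indicator 1) atTop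
      (𝓝 (M.stateTotal x ⬝ᵥ C.indicator 1)) := by
  refine tendsto_mass_of_balance (y := M.stateTotal y) π.transMatrix_mem_rowStochastic
    (fun s hs s' h => hC s hs s' (π.edge_of_posEdge h)) (hπ.stateTotal_x_vecMul hxy) fun n => ?_
  rw [pow_succ', ← mulVec_mulVec]
  exact hπ.balance_of_constOnTSCCs hxy (π.constOnTSCCs_pow_mulVec (M.constOnTSCCs_indicator hC) n)

theorem tendsto_vecMul_pow_of_notMem_recurrentSet (hπ : π.IsDerivedFrom x y)
    (hxy : M.Feasible x y) {s : S} (hs : s ∉ M.recurrentSet) :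
    Tendsto (fun n => (M.β ᵥ* π.transMatrix ^ n) s) atTop (𝓝 (M.stateTotal x s)) := by
  have hmass := hπ.tendsto_mass hxy M.isAbsorbing_recurrentSet
  rw [hπ.stateTotal_x_dotProduct_indicator_recurrentSet hxy] at hmass
  rw [hxy.stateTotal_x_eq_zero hs]
  exact tendsto_apply_zero_of_tendsto_mass_one (fun n => vecMul_mem_stdSimplex
    (pow_mem π.transMatrix_mem_rowStochastic n) M.initial_mem_stdSimplex) hmass hs

theorem tendsto_cesaroMean (hπ : π.IsDerivedFrom x y) (hxy : M.Feasible x y)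
    (huni : ∀ C, M.IsTSCC C → {D | π.IsRecurrentClass D ∧ D ⊆ C}.Subsingleton) :
    Tendsto (cesaroMean π.transMatrix M.β) atTop (𝓝 (M.stateTotal x)) :=
  tendsto_cesaroMean_of_tendsto_mass π.transMatrix_mem_rowStochastic M.initial_mem_stdSimplex
    (hπ.stateTotal_x_vecMul hxy) (𝒞 := {C | M.IsTSCC C})
    (fun _ hC s hs s' h => hC.1.2 s hs s' (π.edge_of_posEdge h)) huni
    (fun _ hC => hπ.tendsto_mass hxy hC.1.2)
    fun _ hs => hπ.tendsto_vecMul_pow_of_notMem_recurrentSet hxy hs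

end IsDerivedFrom

end Policy

end SteadyState

theorem mainTheorem3_general {S A : Type*} [Fintype S] [Fintype A] {M : SteadyState.MDP S A}
    {x y : S → A → ℝ} (hxy : M.Feasible x y) {π : SteadyState.Policy M}
    (hπ : π.IsDerivedFrom x y)
    (huni : ∀ C, M.IsTSCC C → {D | π.IsRecurrentClass D ∧ D ⊆ C}.Subsingleton) :
    π.HasSteadyStateDistribution x := by
  classical
  intro s a ha
  have hlim := (tendsto_pi_nhds.1 (hπ.tendsto_cesaroMean hxy huni) s).mul_const (π.prob s a)
  rw [hπ.stateTotal_x_mul_prob hxy ha] at hlim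
  refine hlim.congr fun n => ?_
  simp only [π.stateActionProb_eq, ← Finset.sum_mul, SteadyState.cesaroMean, Pi.smul_apply,
    Finset.sum_apply, smul_eq_mul, one_div, mul_assoc]

theorem mainTheorem3 {S A : Type*} [Fintype S] [Fintype A] (M : SteadyState.MDP S A)
    (x y : S → A → ℝ) (hxy : M.Feasible x y)
    (π : SteadyState.Policy M) (hπ : π.IsDerivedFrom x y) (hcpu : π.IsCPU) :
    π.HasSteadyStateDistribution x :=
  mainTheorem3_general hxy hπ fun C hC _ hD _ hD' => (hcpu.unichain C hC).unique hD hD'
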